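/- Let $\mathcal H$ be a finite-dimensional complex Hilbert space, $|G\rangle\in\mathcal H$ a unit vector (for instance, a qudit graph state), and $0\le\lambda<1$. Put $$\Omega=|G\rangle\langle G|+\lambda\,(\mathbb 1-|G\rangle\langle G|),\qquad \overline\Omega=\mathbb 1-\Omega .$$ For integers $k\ge 0$ and $N\ge k+1$ and a permutation-invariant density operator $\rho$ on $\mathcal H^{\otimes(N+1)}$ let $$p_k(\rho)=\sum_{i=0}^k\binom Ni\operatorname{tr}\big([\Omega^{\otimes(N-i)}\otimes\overline\Omega^{\otimes i}\otimes\mathbb 1]\rho\big),\qquad f_k(\rho)=\sum_{i=0}^k\binom Ni\operatorname{tr}\big([\Omega^{\otimes(N-i)}\otimes\overline\Omega^{\otimes i}\otimes|G\rangle\langle G|]\rho\big),$$ and $F_k(\rho)=f_k(\rho)/p_k(\rho)$ when $p_k(\rho)>0$. For $0<\delta\le 1$ define the adversarial guaranteed infidelity $$\bar\epsilon_\lambda(k,N,\delta)=1-\min_\rho\{F_k(\rho)\mid p_k(\rho)\ge\delta\},$$ where $\rho$ runs over the permutation-invariant density operators on $\mathcal H^{\otimes(N+1)}$. Then this minimum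 exists, and, on the domain $0<\delta\le1$, $k\in\mathbb Z^{\ge0}$, $N\in\mathbb Z^{\ge k+1}$, $\bar\epsilon_\lambda(k,N,\delta)$ is nonincreasing in $\delta$ (for fixed $k,N$), nonincreasing in $N$ (for fixed $k,\delta$) and nondecreasing in $k$ (for fixed $N,\delta$). -/

import Mathlib

open scoped Matrix ComplexOrder

noncomputable section

namespace GraphVerification

variable {ι : Type*} [Fintype ι] [DecidableEq ι]

/-- The projector `|G⟩⟨G|` onto a vector `G` of the Hilbert space `ℂ^ι`. -/
def targetProj (G : EuclideanSpace ℂ ι) : Matrix ι ι ℂ :=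
  Matrix.of fun a b => G a * star (G b)

/-- The verification operator `Ω = |G⟩⟨G| + lam (1 - |G⟩⟨G|)`. -/
def verifOp (G : EuclideanSpace ℂ ι) (lam : ℝ) : Matrix ι ι ℂ :=
  targetProj G + (lam : ℂ) • (1 - targetProj G)

/-- The tensor product `A 0 ⊗ A 1 ⊗ ⋯ ⊗ A (m - 1)`, as a matrix in the product basis of
`(ℂ^ι)^{⊗ m}`, which is indexed by `Fin m → ι`. -/
def tensorOp {m : ℕ} (A : Fin m → Matrix ι ι ℂ) : Matrix (Fin m → ι) (Fin m → ι) ℂ :=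
  Matrix.of fun x y => ∏ j, A j (x j) (y j)

/-- The operator `Ω^{⊗ (N - i)} ⊗ (1 - Ω)^{⊗ i} ⊗ E` on `N + 1` systems. -/
def testOp (Ω E : Matrix ι ι ℂ) (N i : ℕ) :
    Matrix (Fin (N + 1) → ι) (Fin (N + 1) → ι) ℂ :=
  tensorOp fun j => if (j : ℕ) < N - i then Ω else if (j : ℕ) < N then 1 - Ω else E

/-- Density operators: positive semidefinite of trace one. -/
def IsDensity {κ : Type*} [Fintype κ] (ρ : Matrix κ κ ℂ) : Prop :=
  ρ.PosSemidef ∧ ρ.trace = 1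

/-- Invariance under conjugation by every permutation of the `m` tensor factors. -/
def IsPermInvariant {m : ℕ} (ρ : Matrix (Fin m → ι) (Fin m → ι) ℂ) : Prop :=
  ∀ (π : Equiv.Perm (Fin m)) (x y : Fin m → ι), ρ (x ∘ π) (y ∘ π) = ρ x y

/-- `p_k(ρ)`: the probability that at most `k` of the `N` tests fail. -/
def acceptProb (G : EuclideanSpace ℂ ι) (lam : ℝ) (k N : ℕ)
    (ρ : Matrix (Fin (N + 1) → ι) (Fin (N + 1) → ι) ℂ) : ℝ :=
  ∑ i ∈ Finset.range (k + 1),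
    (N.choose i : ℝ) * (testOp (verifOp G lam) 1 N i * ρ).trace.re

/-- `f_k(ρ)`: the same sum with the projector `|G⟩⟨G|` on the remaining system. -/
def acceptFid (G : EuclideanSpace ℂ ι) (lam : ℝ) (k N : ℕ)
    (ρ : Matrix (Fin (N + 1) → ι) (Fin (N + 1) → ι) ℂ) : ℝ :=
  ∑ i ∈ Finset.range (k + 1),
    (N.choose i : ℝ) * (testOp (verifOp G lam) (targetProj G) N i * ρ).trace.re

/-- `F_k(ρ) = f_k(ρ) / p_k(ρ)`: the fidelity between the reduced state on the remaining system,
conditioned on acceptance, and the target state (used only where `p_k(ρ) > 0`). -/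
def fidelity (G : EuclideanSpace ℂ ι) (lam : ℝ) (k N : ℕ)
    (ρ : Matrix (Fin (N + 1) → ι) (Fin (N + 1) → ι) ℂ) : ℝ :=
  acceptFid G lam k N ρ / acceptProb G lam k N ρ

/-- The set of fidelities `F_k(ρ)` over the permutation-invariant states `ρ` on `N + 1` systems
with `p_k(ρ) ≥ δ`. -/
def feasibleFidelities (G : EuclideanSpace ℂ ι) (lam : ℝ) (k N : ℕ) (δ : ℝ) : Set ℝ :=
  {F | ∃ ρ : Matrix (Fin (N + 1) → ι) (Fin (N + 1) → ι) ℂ,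
    IsDensity ρ ∧ IsPermInvariant ρ ∧ δ ≤ acceptProb G lam k N ρ ∧ F = fidelity G lam k N ρ}

/-- The guaranteed infidelity `1 - min {F_k(ρ) | p_k(ρ) ≥ δ}`. -/
def guaranteedInfidelity (G : EuclideanSpace ℂ ι) (lam : ℝ) (k N : ℕ) (δ : ℝ) : ℝ :=
  1 - sInf (feasibleFidelities G lam k N δ)

end GraphVerification

end

noncomputable section

namespace GraphVerification

/-! The operators `Ω`, `1 - Ω` and `|G⟩⟨G|` all commute with `|G⟩⟨G|`, so a permutation-invariant
state enters only through the probabilities `c j` that exactly `j` of the `N + 1` systems are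
orthogonal to the target. A target system always passes and an orthogonal one passes with
probability `lam`. Hence `p_k` and `f_k` are the averages under `c` of `accPoint` and `fidPoint`
(`acceptProb_eq`, `acceptFid_eq`), with `K = k + 1`. In dimension at least two every `c` occurs
(`feasibleFidelities_eq_ratioSet`), and the minimum exists by compactness of the simplex; in
dimension one the only fidelity is `1`.

Monotonicity in `δ` is inclusion of feasible sets. For `k` and `N` it suffices that every point of
one family is dominated by a subconvex combination of the points of the other, since normalizing the
weights keeps the ratio and can only raise the acceptance (`exists_le_of_subset_dominated`). For
`k`, the point `j` is dominated by a multiple of the point `j + 1` with one more failure allowed;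
the core is `mul_passProb_le`, a comparison of truncated binomial means. For `N`, conditioning on
one tested system writes a point for `N + 1` as a convex combination of points for `N` with `K + 1`
or `K`, and the latter are absorbed by the step in `k`. -/

/-- The probability of `i` failures among `j` independent tests, each passed with probability
`lam`. -/
def binomTerm (lam : ℝ) (j i : ℕ) : ℝ := (j.choose i : ℝ) * (1 - lam) ^ i * lam ^ (j - i)

/-- The probability of fewer than `K` failures among `j` independent tests. -/
def passProb (lam : ℝ) (j K : ℕ) : ℝ := ∑ i ∈ Finset.range K, binomTerm lam j i

/-- The acceptance probability when `j` of the `N + 1` systems are orthogonal to the target and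
fewer than `K` failures are allowed. -/
def accPoint (lam : ℝ) (K N j : ℕ) : ℝ :=
  (((N : ℝ) + 1 - j) * passProb lam j K + j * passProb lam (j - 1) K) / ((N : ℝ) + 1)

/-- The probability of acceptance with the remaining system in the target state, when `j` of the
`N + 1` systems are orthogonal to the target. -/
def fidPoint (lam : ℝ) (K N j : ℕ) : ℝ :=
  ((N : ℝ) + 1 - j) * passProb lam j K / ((N : ℝ) + 1)

/-! ### Truncated binomial sums. -/

section Binomial

variable {lam : ℝ}

lemma binomTerm_nonneg (h0 : 0 ≤ lam) (h1 : lam < 1) (j i : ℕ) : 0 ≤ binomTerm lam j i := by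
  have : 0 ≤ 1 - lam := by linarith
  unfold binomTerm
  positivity

lemma binomTerm_zero_right (j : ℕ) : binomTerm lam (j + 1) 0 = lam * binomTerm lam j 0 := by
  simp [binomTerm, pow_succ, mul_comm]

lemma binomTerm_of_lt {j i : ℕ} (h : j < i) : binomTerm lam j i = 0 := by
  simp [binomTerm, Nat.choose_eq_zero_of_lt h]

lemma binomTerm_succ_succ (j i : ℕ) :
    binomTerm lam (j + 1) (i + 1) =
      lam * binomTerm lam j (i + 1) + (1 - lam) * binomTerm lam j i := by
  rcases le_or_gt (i + 1) j with h | h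
  · obtain ⟨m, rfl⟩ := Nat.exists_eq_add_of_le h
    have e1 : i + 1 + m + 1 - (i + 1) = m + 1 := by omega
    have e2 : i + 1 + m - (i + 1) = m := by omega
    have e3 : i + 1 + m - i = m + 1 := by omega
    simp only [binomTerm, Nat.choose_succ_succ (i + 1 + m) i, e1, e2, e3]
    push_cast
    ring
  · rw [binomTerm_of_lt h]
    have hz : j.choose (i + 1) = 0 := Nat.choose_eq_zero_of_lt h
    simp only [binomTerm, Nat.choose_succ_succ j i, hz, Nat.add_sub_add_right]
    push_cast
    ring

lemma succ_mul_binomTerm (j i : ℕ) :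
    ((i : ℝ) + 1) * binomTerm lam (j + 1) (i + 1) = (1 - lam) * ((j + 1) * binomTerm lam j i) := by
  have h : ((j : ℝ) + 1) * j.choose i = (j + 1).choose (i + 1) * ((i : ℝ) + 1) := by
    exact_mod_cast Nat.add_one_mul_choose_eq j i
  simp only [binomTerm, Nat.add_sub_add_right]
  linear_combination (-(1 - lam) ^ (i + 1) * lam ^ (j - i)) * h

lemma sub_mul_binomTerm {j i : ℕ} (h : i ≤ j) :
    ((j : ℝ) + 1 - i) * binomTerm lam (j + 1) i = lam * ((j + 1) * binomTerm lam j i) := by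
  obtain ⟨m, rfl⟩ := Nat.exists_eq_add_of_le h
  have e1 : i + m + 1 - i = m + 1 := by omega
  have e2 : i + m - i = m := by omega
  have h : ((i + m : ℕ) + 1 : ℝ) * (i + m).choose i = (i + m + 1).choose i * ((m : ℝ) + 1) := by
    have := Nat.choose_mul_succ_eq (i + m) i
    rw [e1] at this
    exact_mod_cast (mul_comm _ _).trans this
  simp only [binomTerm, e1, e2]
  push_cast at h ⊢
  linear_combination (-(1 - lam) ^ i * lam ^ (m + 1)) * h

lemma passProb_nonneg (h0 : 0 ≤ lam) (h1 : lam < 1) (j K : ℕ) : 0 ≤ passProb lam j K :=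
  Finset.sum_nonneg fun _ _ => binomTerm_nonneg h0 h1 _ _

lemma passProb_zero_left (K : ℕ) : passProb lam 0 (K + 1) = 1 := by
  rw [passProb, Finset.sum_range_succ', Finset.sum_eq_zero fun i _ => binomTerm_of_lt (by omega)]
  simp [binomTerm]

lemma passProb_succ_succ (j K : ℕ) :
    passProb lam (j + 1) (K + 1) = lam * passProb lam j (K + 1) + (1 - lam) * passProb lam j K := by
  rw [passProb, Finset.sum_range_succ', passProb, Finset.sum_range_succ' _ K, passProb,
    binomTerm_zero_right]
  simp only [binomTerm_succ_succ, Finset.sum_add_distrib, ← Finset.mul_sum]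
  ring

lemma passProb_le_succ_right (h0 : 0 ≤ lam) (h1 : lam < 1) (j K : ℕ) :
    passProb lam j K ≤ passProb lam j (K + 1) := by
  rw [passProb, passProb, Finset.sum_range_succ]
  linarith [binomTerm_nonneg h0 h1 j K]

/-- One more allowed failure compensates for one more test. -/
lemma passProb_le_succ_succ (h0 : 0 ≤ lam) (h1 : lam < 1) (j K : ℕ) :
    passProb lam j K ≤ passProb lam (j + 1) (K + 1) := by
  rw [passProb_succ_succ]
  nlinarith [passProb_le_succ_right h0 h1 j K]

/-- The factor `m` makes the truncated `m - 1` harmless at `m = 0`. -/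
lemma natCast_mul_passProb (m K : ℕ) :
    (m : ℝ) * passProb lam m (K + 1) =
      m * (lam * passProb lam (m - 1) (K + 1) + (1 - lam) * passProb lam (m - 1) K) := by
  cases m with
  | zero => simp
  | succ m => rw [passProb_succ_succ, Nat.add_sub_cancel]

lemma sum_mul_binomTerm (j K : ℕ) :
    ∑ i ∈ Finset.range (K + 1), (i : ℝ) * binomTerm lam j i =
      (1 - lam) * (j * passProb lam (j - 1) K) := by
  rw [Finset.sum_range_succ']
  cases j with
  | zero => simp [binomTerm]
  | succ j =>
    have h (i : ℕ) := succ_mul_binomTerm (lam := lam) j i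
    push_cast
    simp only [h, passProb, ← Finset.mul_sum]
    ring

/-- Monotone likelihood ratio: for `i ≤ j`, passing from `j` to `j + 1` tests multiplies the term by
`lam * (j + 1) / (j + 1 - i)`, which grows with `i`. -/
lemma binomTerm_mul_le (h0 : 0 ≤ lam) (h1 : lam < 1) (j : ℕ) {i l : ℕ} (h : i ≤ l) :
    binomTerm lam j l * binomTerm lam (j + 1) i ≤ binomTerm lam j i * binomTerm lam (j + 1) l := by
  have hn := binomTerm_nonneg h0 h1
  rcases le_or_gt l j with hl | hl
  · have e1 := sub_mul_binomTerm (lam := lam) hl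
    have e2 := sub_mul_binomTerm (lam := lam) (h.trans hl)
    have hl' : (l : ℝ) ≤ j := by exact_mod_cast hl
    have hi' : (i : ℝ) ≤ l := by exact_mod_cast h
    have p1 : 0 < (j : ℝ) + 1 - l := by linarith
    have p2 : 0 < (j : ℝ) + 1 - i := by linarith
    refine le_of_mul_le_mul_left ?_ (mul_pos p1 p2)
    have k1 : ((j : ℝ) + 1 - l) * (j + 1 - i) * (binomTerm lam j l * binomTerm lam (j + 1) i) =
        (j + 1 - l) * (lam * (j + 1) * (binomTerm lam j l * binomTerm lam j i)) := by
      linear_combination ((j : ℝ) + 1 - l) * binomTerm lam j l * e2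
    have k2 : ((j : ℝ) + 1 - l) * (j + 1 - i) * (binomTerm lam j i * binomTerm lam (j + 1) l) =
        (j + 1 - i) * (lam * (j + 1) * (binomTerm lam j l * binomTerm lam j i)) := by
      linear_combination ((j : ℝ) + 1 - i) * binomTerm lam j i * e1
    rw [k1, k2]
    have := mul_nonneg (hn j l) (hn j i)
    exact mul_le_mul_of_nonneg_right (by linarith) (by positivity)
  · rw [binomTerm_of_lt hl, zero_mul]
    exact mul_nonneg (hn _ _) (hn _ _)

/-- The ratio `(j + 1) * passProb j K / passProb (j + 1) K` does not decrease when `j` and `K`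
increase together. -/
lemma mul_passProb_le (h0 : 0 ≤ lam) (h1 : lam < 1) (j K : ℕ) :
    j * passProb lam (j - 1) K * passProb lam (j + 1) (K + 1) ≤
      (j + 1) * passProb lam j (K + 1) * passProb lam j K := by
  -- By `sum_mul_binomTerm`, the claim compares the mean numbers of failures in `j` and `j + 1`
  -- tests, each conditioned on at most `K` failures. The double sum is the difference of these
  -- means, cleared of denominators.
  set R := Finset.range (K + 1)
  have hD : ∑ i ∈ R, ∑ l ∈ R, ((l : ℝ) - i) * (binomTerm lam j i * binomTerm lam (j + 1) l) =
      (1 - lam) * ((j + 1) * passProb lam j (K + 1) * passProb lam j K -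
        j * passProb lam (j - 1) K * passProb lam (j + 1) (K + 1)) := by
    have e1 := sum_mul_binomTerm (lam := lam) j K
    have e2 := sum_mul_binomTerm (lam := lam) (j + 1) K
    rw [Nat.add_sub_cancel] at e2
    push_cast at e2
    calc _ = (∑ i ∈ R, binomTerm lam j i) * (∑ l ∈ R, (l : ℝ) * binomTerm lam (j + 1) l) -
          (∑ i ∈ R, (i : ℝ) * binomTerm lam j i) * (∑ l ∈ R, binomTerm lam (j + 1) l) := by
          rw [Finset.sum_mul_sum, Finset.sum_mul_sum, ← Finset.sum_sub_distrib]
          refine Finset.sum_congr rfl fun i _ => ?_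
          rw [← Finset.sum_sub_distrib]
          exact Finset.sum_congr rfl fun l _ => by ring
      _ = _ := by
          rw [e1, e2]
          change passProb lam j (K + 1) * _ - _ * passProb lam (j + 1) (K + 1) = _
          ring
  -- Swapping `i` and `l` symmetrizes the sum; each term is then a product of two factors of the
  -- same sign.
  have hS : 2 * ∑ i ∈ R, ∑ l ∈ R, ((l : ℝ) - i) * (binomTerm lam j i * binomTerm lam (j + 1) l) =
      ∑ i ∈ R, ∑ l ∈ R, ((l : ℝ) - i) * (binomTerm lam j i * binomTerm lam (j + 1) l -
        binomTerm lam j l * binomTerm lam (j + 1) i) := by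
    rw [two_mul]
    nth_rewrite 2 [Finset.sum_comm]
    rw [← Finset.sum_add_distrib]
    refine Finset.sum_congr rfl fun i _ => ?_
    rw [← Finset.sum_add_distrib]
    exact Finset.sum_congr rfl fun l _ => by ring
  have hpos : 0 ≤ ∑ i ∈ R, ∑ l ∈ R, ((l : ℝ) - i) *
      (binomTerm lam j i * binomTerm lam (j + 1) l -
        binomTerm lam j l * binomTerm lam (j + 1) i) := by
    refine Finset.sum_nonneg fun i _ => Finset.sum_nonneg fun l _ => ?_
    rcases le_total i l with h | h
    · have : (i : ℝ) ≤ l := by exact_mod_cast h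
      exact mul_nonneg (by linarith) (by linarith [binomTerm_mul_le h0 h1 j h])
    · have : (l : ℝ) ≤ i := by exact_mod_cast h
      exact mul_nonneg_of_nonpos_of_nonpos (by linarith) (by linarith [binomTerm_mul_le h0 h1 j h])
  have := nonneg_of_mul_nonneg_right (a := 1 - lam) (by rw [← hD]; linarith) (by linarith)
  linarith

end Binomial

/-! ### Domination between the families of extreme points. -/

section Points

variable {lam : ℝ}

lemma accPoint_nonneg (h0 : 0 ≤ lam) (h1 : lam < 1) (K : ℕ) {N j : ℕ} (hj : j ≤ N + 1) :
    0 ≤ accPoint lam K N j := by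
  have : (j : ℝ) ≤ N + 1 := by exact_mod_cast hj
  have := passProb_nonneg h0 h1 (j - 1) K
  exact div_nonneg (add_nonneg (mul_nonneg (by linarith) (passProb_nonneg h0 h1 j K))
    (by positivity)) (by positivity)

lemma fidPoint_nonneg (h0 : 0 ≤ lam) (h1 : lam < 1) (K : ℕ) {N j : ℕ} (hj : j ≤ N + 1) :
    0 ≤ fidPoint lam K N j := by
  have : (j : ℝ) ≤ N + 1 := by exact_mod_cast hj
  exact div_nonneg (mul_nonneg (by linarith) (passProb_nonneg h0 h1 j K)) (by positivity)

lemma accPoint_zero (K N : ℕ) : accPoint lam (K + 1) N 0 = 1 := by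
  have : (N : ℝ) + 1 ≠ 0 := by positivity
  simp [accPoint, passProb_zero_left, this]

lemma fidPoint_zero (K N : ℕ) : fidPoint lam (K + 1) N 0 = 1 := by
  have : (N : ℝ) + 1 ≠ 0 := by positivity
  simp [fidPoint, passProb_zero_left, this]

/-- The pairs dominated by a subconvex combination of the points `(accPoint, fidPoint)`. -/
def dominated (lam : ℝ) (K N : ℕ) : Set (ℝ × ℝ) :=
  {x | ∃ c : Fin (N + 2) → ℝ, (∀ j, 0 ≤ c j) ∧ ∑ j, c j ≤ 1 ∧
    x.1 ≤ ∑ j, c j * accPoint lam K N j ∧ ∑ j, c j * fidPoint lam K N j ≤ x.2}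

lemma convex_dominated (K N : ℕ) : Convex ℝ (dominated lam K N) := by
  rintro x ⟨c, c0, c1, cp, cf⟩ y ⟨d, d0, d1, dp, df⟩ a b ha hb hab
  have key (g : Fin (N + 2) → ℝ) : ∑ j, (a * c j + b * d j) * g j =
      a * ∑ j, c j * g j + b * ∑ j, d j * g j := by
    rw [Finset.mul_sum, Finset.mul_sum, ← Finset.sum_add_distrib]
    exact Finset.sum_congr rfl fun _ _ => by ring
  refine ⟨fun j => a * c j + b * d j, fun j => ?_, ?_, ?_, ?_⟩
  · exact add_nonneg (mul_nonneg ha (c0 j)) (mul_nonneg hb (d0 j))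
  · have := key fun _ => 1
    simp only [mul_one] at this
    rw [this]
    nlinarith
  · rw [key]
    exact add_le_add (mul_le_mul_of_nonneg_left cp ha) (mul_le_mul_of_nonneg_left dp hb)
  · rw [key]
    exact add_le_add (mul_le_mul_of_nonneg_left cf ha) (mul_le_mul_of_nonneg_left df hb)

lemma mem_dominated_of_le {K N j : ℕ} (hj : j ≤ N + 1) {s p f : ℝ} (hs0 : 0 ≤ s) (hs1 : s ≤ 1)
    (hp : p ≤ s * accPoint lam K N j) (hf : s * fidPoint lam K N j ≤ f) :
    (p, f) ∈ dominated lam K N := by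
  refine ⟨Pi.single ⟨j, by omega⟩ s, fun i => ?_, ?_, ?_, ?_⟩
  · rw [Pi.single_apply]
    split_ifs <;> simp [hs0]
  · simpa using hs1
  · simpa [Pi.single_apply] using hp
  · simpa [Pi.single_apply] using hf

lemma mem_dominated_self {K N j : ℕ} (hj : j ≤ N + 1) :
    (accPoint lam K N j, fidPoint lam K N j) ∈ dominated lam K N :=
  mem_dominated_of_le hj zero_le_one le_rfl (by simp) (by simp)

lemma mem_dominated_succ_right (h0 : 0 ≤ lam) (h1 : lam < 1) {K N j : ℕ} (hj : j ≤ N + 1) :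
    (accPoint lam K N j, fidPoint lam K N j) ∈ dominated lam (K + 1) N := by
  have hN : (0 : ℝ) < (N : ℝ) + 1 := by positivity
  have hn := passProb_nonneg h0 h1
  rcases hj.lt_or_eq with hj | rfl
  · have hj' : (j : ℝ) + 1 ≤ N + 1 := by exact_mod_cast hj
    -- The scale is the quotient of these two acceptances, so that the first coordinates agree.
    have hle : accPoint lam K N j ≤ accPoint lam (K + 1) N (j + 1) := by
      unfold accPoint
      refine div_le_div_of_nonneg_right ?_ hN.le
      rw [Nat.add_sub_cancel]
      push_cast
      have a1 := passProb_le_succ_succ h0 h1 j K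
      have a2 : (j : ℝ) * passProb lam (j - 1) K ≤ j * passProb lam j (K + 1) := by
        cases j with
        | zero => simp
        | succ j =>
          exact mul_le_mul_of_nonneg_left (passProb_le_succ_succ h0 h1 j K) (by positivity)
      have a3 := passProb_le_succ_right h0 h1 j K
      nlinarith
    have h0' := accPoint_nonneg h0 h1 K hj.le
    -- If the larger acceptance vanishes, so does the smaller, and the weight `0` suffices.
    rcases (h0'.trans hle).eq_or_lt with hz | hpos
    · exact mem_dominated_of_le (j := j) hj.le le_rfl zero_le_one (by linarith)
        (by simpa using fidPoint_nonneg h0 h1 K hj.le)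
    · refine mem_dominated_of_le (j := j + 1) hj (div_nonneg h0' hpos.le)
        (div_le_one_of_le₀ hle hpos.le) (div_mul_cancel₀ _ hpos.ne').ge ?_
      rw [div_mul_eq_mul_div, div_le_iff₀ hpos]
      unfold accPoint fidPoint
      rw [Nat.add_sub_cancel, div_mul_div_comm, div_mul_div_comm]
      refine div_le_div_of_nonneg_right ?_ (by positivity)
      have hA := mul_passProb_le h0 h1 j K
      have hpr : 0 ≤ ((j : ℝ) + 1) * passProb lam j (K + 1) * passProb lam j K :=
        mul_nonneg (mul_nonneg (by positivity) (hn _ _)) (hn _ _)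
      push_cast
      nlinarith [mul_le_mul_of_nonneg_left hA (sub_nonneg.2 hj')]
  -- With every system orthogonal there is no index `j + 1`, but the second coordinate is `0` and
  -- the same index serves.
  · refine mem_dominated_of_le (j := N + 1) le_rfl zero_le_one le_rfl ?_ ?_
    · rw [one_mul]
      unfold accPoint
      refine div_le_div_of_nonneg_right ?_ hN.le
      rw [Nat.add_sub_cancel]
      push_cast
      rw [sub_self, zero_mul, zero_mul, zero_add, zero_add]
      exact mul_le_mul_of_nonneg_left (passProb_le_succ_right h0 h1 N K) hN.le
    · simp [fidPoint]

lemma mem_dominated_of_succ_left (h0 : 0 ≤ lam) (h1 : lam < 1) {K N j : ℕ} (hj : j ≤ N + 2) :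
    (accPoint lam (K + 1) (N + 1) j, fidPoint lam (K + 1) (N + 1) j) ∈
      dominated lam (K + 1) N := by
  have hN1 : (N : ℝ) + 1 ≠ 0 := by positivity
  have hN2 : (N : ℝ) + 1 + 1 ≠ 0 := by positivity
  have hl : 0 ≤ 1 - lam := by linarith
  cases j with
  | zero =>
    rw [accPoint_zero, fidPoint_zero, ← accPoint_zero (lam := lam) K N]
    nth_rewrite 2 [accPoint_zero]
    rw [← fidPoint_zero (lam := lam) K N]
    exact mem_dominated_self (Nat.zero_le _)
  | succ m =>
    have hm : m ≤ N + 1 := by omega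
    have hm' : (m : ℝ) ≤ N + 1 := by exact_mod_cast hm
    have hrec := natCast_mul_passProb (lam := lam) m K
    -- One tested system is singled out and found orthogonal: it passes with probability `lam`, and
    -- otherwise uses up one allowed failure.
    have hy : (lam • (accPoint lam (K + 1) N m, fidPoint lam (K + 1) N m) +
        (1 - lam) • (accPoint lam K N m, fidPoint lam K N m)) ∈ dominated lam (K + 1) N :=
      convex_dominated _ _ (mem_dominated_self hm) (mem_dominated_succ_right h0 h1 hm) h0 hl
        (by ring)
    rcases hm.lt_or_eq with hlt | rfl
    · have hx := mem_dominated_self (lam := lam) (K := K + 1) (show m + 1 ≤ N + 1 by omega)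
      -- The weights are the probabilities that the singled-out system is a target or is orthogonal,
      -- given `m + 1` orthogonal ones among `N + 2`. For `m = N + 1` only the second case occurs.
      have := convex_dominated _ _ hx hy (a := ((N : ℝ) + 1 - m) / (N + 1 + 1))
        (b := ((m : ℝ) + 1) / (N + 1 + 1)) (div_nonneg (by linarith) (by positivity))
        (by positivity) (by field_simp; ring)
      convert this using 1
      simp only [Prod.smul_mk, Prod.mk_add_mk, smul_eq_mul, Prod.mk.injEq]
      unfold accPoint fidPoint
      have e := passProb_succ_succ (lam := lam) m K
      rw [Nat.add_sub_cancel]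
      push_cast
      constructor
      · field_simp
        linear_combination ((m : ℝ) + 1) * ((N : ℝ) + 1 - m) * e + ((m : ℝ) + 1) * hrec
      · field_simp
        linear_combination ((m : ℝ) + 1) * ((N : ℝ) + 1 - m) * e
    · convert hy using 1
      simp only [Prod.smul_mk, Prod.mk_add_mk, smul_eq_mul, Prod.mk.injEq]
      unfold accPoint fidPoint
      rw [Nat.add_sub_cancel]
      push_cast at hrec ⊢
      rw [mul_right_inj' hN1] at hrec
      constructor
      · field_simp
        linear_combination hrec
      · field_simp
        ring

end Points

/-! ### The minimization over the simplex. -/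

section Classical

variable {lam : ℝ}

/-- The ratios of the convex combinations of the points `(accPoint, fidPoint)` with first
coordinate at least `δ`. -/
def ratioSet (lam : ℝ) (K N : ℕ) (δ : ℝ) : Set ℝ :=
  {F | ∃ c ∈ stdSimplex ℝ (Fin (N + 2)), δ ≤ ∑ j, c j * accPoint lam K N j ∧
    F = (∑ j, c j * fidPoint lam K N j) / ∑ j, c j * accPoint lam K N j}

lemma exists_isLeast_ratioSet (K N : ℕ) {δ : ℝ} (hδ : 0 < δ) (hδ1 : δ ≤ 1) :
    ∃ m, IsLeast (ratioSet lam (K + 1) N δ) m := by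
  have hc (g : Fin (N + 2) → ℝ) : Continuous fun c : Fin (N + 2) → ℝ => ∑ j, c j * g j := by
    fun_prop
  have hK : IsCompact (stdSimplex ℝ (Fin (N + 2)) ∩
      {c | δ ≤ ∑ j, c j * accPoint lam (K + 1) N j}) :=
    (isCompact_stdSimplex ℝ _).inter_right (isClosed_le continuous_const (hc _))
  have hne : (stdSimplex ℝ (Fin (N + 2)) ∩
      {c | δ ≤ ∑ j, c j * accPoint lam (K + 1) N j}).Nonempty := by
    refine ⟨Pi.single 0 1, single_mem_stdSimplex ℝ 0, ?_⟩
    simpa [Pi.single_apply, accPoint_zero] using hδ1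
  obtain ⟨c, ⟨hc1, hc2⟩, hmin⟩ := hK.exists_isMinOn hne
    (f := fun c => (∑ j, c j * fidPoint lam (K + 1) N j) / ∑ j, c j * accPoint lam (K + 1) N j)
    ((hc _).continuousOn.div (hc _).continuousOn fun x hx => (hδ.trans_le hx.2).ne')
  refine ⟨_, ⟨c, hc1, hc2, rfl⟩, ?_⟩
  rintro F ⟨d, hd1, hd2, rfl⟩
  exact hmin ⟨hd1, hd2⟩

lemma exists_le_of_subset_dominated {K N K' N' : ℕ} {δ : ℝ} (hδ : 0 < δ)
    (h0 : 0 ≤ lam) (h1 : lam < 1)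
    (h : ∀ j ≤ N' + 1, (accPoint lam K' N' j, fidPoint lam K' N' j) ∈ dominated lam K N)
    {F : ℝ} (hF : F ∈ ratioSet lam K' N' δ) : ∃ F' ∈ ratioSet lam K N δ, F' ≤ F := by
  obtain ⟨c, hc, hδc, rfl⟩ := hF
  have hmem := (convex_dominated (lam := lam) K N).sum_mem (t := Finset.univ) (w := c)
    (z := fun j : Fin (N' + 2) => (accPoint lam K' N' j, fidPoint lam K' N' j))
    (fun j _ => hc.1 j) hc.2 (fun j _ => h j (by omega))
  obtain ⟨d, d0, d1, dp, df⟩ := hmem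
  simp only [Prod.smul_mk, Prod.fst_sum, Prod.snd_sum, smul_eq_mul] at dp df
  have hdp := hδc.trans dp
  -- Zero total weight would give zero acceptance, contradicting `0 < δ`.
  have hsum : 0 < ∑ j, d j := by
    refine (Finset.sum_nonneg fun j _ => d0 j).lt_of_ne fun hz => ?_
    have := (Finset.sum_eq_zero_iff_of_nonneg fun j _ => d0 j).1 hz.symm
    rw [Finset.sum_eq_zero fun j hj => by rw [this j hj, zero_mul]] at hdp
    linarith
  have hscale (g : Fin (N + 2) → ℝ) :
      ∑ j, d j / (∑ i, d i) * g j = (∑ j, d j * g j) / ∑ i, d i := by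
    rw [Finset.sum_div]
    exact Finset.sum_congr rfl fun j _ => by ring
  refine ⟨_, ⟨fun j => d j / ∑ i, d i, ⟨fun j => div_nonneg (d0 j) hsum.le, ?_⟩, ?_, rfl⟩, ?_⟩
  · rw [← Finset.sum_div, div_self hsum.ne']
  · rw [hscale]
    exact hdp.trans (le_div_self (hδ.le.trans hdp) hsum d1)
  · rw [hscale, hscale, div_div_div_cancel_right₀ hsum.ne']
    refine div_le_div₀ (Finset.sum_nonneg fun j _ => ?_) df (hδ.trans_le hδc) dp
    exact mul_nonneg (hc.1 j) (fidPoint_nonneg h0 h1 K' (by omega))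

end Classical

/-! ### Tensor products and permutations of the factors. -/

section Tensor

variable {ι : Type*}

lemma tensorOp_mul [Fintype ι] {m : ℕ} (A B : Fin m → Matrix ι ι ℂ) :
    tensorOp A * tensorOp B = tensorOp fun j => A j * B j := by
  ext x y
  simp only [tensorOp, Matrix.mul_apply, Matrix.of_apply, ← Finset.prod_mul_distrib]
  rw [Finset.prod_univ_sum, Fintype.piFinset_univ]

lemma conjTranspose_tensorOp {m : ℕ} (A : Fin m → Matrix ι ι ℂ) :
    (tensorOp A)ᴴ = tensorOp fun j => (A j)ᴴ := by
  ext x y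
  simp [tensorOp, Matrix.conjTranspose_apply]

lemma trace_tensorOp [Fintype ι] {m : ℕ} (A : Fin m → Matrix ι ι ℂ) :
    (tensorOp A).trace = ∏ j, (A j).trace := by
  simp only [tensorOp, Matrix.trace, Matrix.diag_apply, Matrix.of_apply]
  rw [Finset.prod_univ_sum, Fintype.piFinset_univ]

lemma tensorOp_one [DecidableEq ι] {m : ℕ} :
    tensorOp (fun _ : Fin m => (1 : Matrix ι ι ℂ)) = 1 := by
  ext x y
  simp only [tensorOp, Matrix.of_apply, Matrix.one_apply, Finset.prod_ite_zero, funext_iff]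
  simp

lemma tensorOp_eq_zero {m : ℕ} {A : Fin m → Matrix ι ι ℂ} {j : Fin m} (h : A j = 0) :
    tensorOp A = 0 := by
  ext x y
  simp only [tensorOp, Matrix.of_apply, Matrix.zero_apply]
  exact Finset.prod_eq_zero (Finset.mem_univ j) (by rw [h]; rfl)

lemma tensorOp_smul_add_smul {m : ℕ} (a b : Fin m → ℂ) (A B : Matrix ι ι ℂ) :
    tensorOp (fun j => a j • A + b j • B) =
      ∑ S : Finset (Fin m), ((∏ j, if j ∈ S then b j else a j)) •
        tensorOp fun j => if j ∈ S then B else A := by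
  ext x y
  simp only [tensorOp, Matrix.of_apply, Matrix.sum_apply, Matrix.smul_apply, Matrix.add_apply,
    smul_eq_mul, ← Finset.prod_mul_distrib]
  -- `Finset.prod_add` assigns the first summand to the chosen subset, which is to carry `b` and
  -- `B`.
  simp only [add_comm (a _ * _)]
  rw [Finset.prod_add, Finset.powerset_univ]
  refine Finset.sum_congr rfl fun S _ => ?_
  rw [← Finset.prod_mul_prod_compl S fun j => (if j ∈ S then b j else a j) *
    (if j ∈ S then B else A) (x j) (y j), Finset.compl_eq_univ_sdiff]
  congr 1
  · exact Finset.prod_congr rfl fun j hj => by simp [hj]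
  · refine Finset.prod_congr rfl fun j hj => ?_
    have : j ∉ S := (Finset.mem_sdiff.1 hj).2
    simp [this]

lemma trace_tensorOp_comp_mul [Fintype ι] {m : ℕ} {ρ : Matrix (Fin m → ι) (Fin m → ι) ℂ}
    (hρ : IsPermInvariant ρ) (A : Fin m → Matrix ι ι ℂ) (π : Equiv.Perm (Fin m)) :
    (tensorOp (A ∘ π) * ρ).trace = (tensorOp A * ρ).trace := by
  have hA (x y : Fin m → ι) : tensorOp (A ∘ π) (x ∘ π) (y ∘ π) = tensorOp A x y :=
    Equiv.prod_comp π fun j => A j (x j) (y j)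
  simp only [Matrix.trace, Matrix.diag_apply, Matrix.mul_apply]
  let e : (Fin m → ι) ≃ (Fin m → ι) := Equiv.arrowCongr π.symm (Equiv.refl ι)
  have he (x : Fin m → ι) : e x = x ∘ π := by
    ext j
    simp [e, Equiv.arrowCongr]
  rw [← Equiv.sum_comp e]
  refine Finset.sum_congr rfl fun x _ => ?_
  rw [← Equiv.sum_comp e]
  refine Finset.sum_congr rfl fun y _ => ?_
  rw [he, he, hA, hρ]

/-- Bijections between fibres of equal size glue to a permutation. -/
lemma exists_perm_comp_eq {α κ : Type*} [Fintype α] [DecidableEq κ] (g g' : α → κ)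
    (h : ∀ c, Fintype.card {x // g x = c} = Fintype.card {x // g' x = c}) :
    ∃ π : Equiv.Perm α, g ∘ π = g' := by
  have e (c : κ) : {x // g' x = c} ≃ {x // g x = c} := (Fintype.equivOfCardEq (h c)).symm
  refine ⟨((Equiv.sigmaFiberEquiv g').symm.trans (Equiv.sigmaCongrRight e)).trans
    (Equiv.sigmaFiberEquiv g), ?_⟩
  ext x
  exact (e (g' x) ⟨x, rfl⟩).2

end Tensor

/-! ### The orthogonal decomposition by the set of systems off target. -/

section Sector

lemma conjTranspose_targetProj {ι : Type*} {G : EuclideanSpace ℂ ι} :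
    (targetProj G)ᴴ = targetProj G := by
  ext a b
  simp [targetProj, Matrix.conjTranspose_apply, mul_comm]

lemma sum_mul_star_self {ι : Type*} [Fintype ι] {G : EuclideanSpace ℂ ι} (hG : ‖G‖ = 1) :
    ∑ a, G a * star (G a) = 1 := by
  have h := EuclideanSpace.norm_sq_eq G
  rw [hG] at h
  have h2 (a : ι) : G a * star (G a) = ((‖G a‖ ^ 2 : ℝ) : ℂ) := by
    rw [Complex.star_def, Complex.mul_conj, Complex.normSq_eq_norm_sq]
  simp only [h2, ← Complex.ofReal_sum, ← h]
  simp

lemma trace_targetProj {ι : Type*} [Fintype ι] {G : EuclideanSpace ℂ ι} (hG : ‖G‖ = 1) :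
    (targetProj G).trace = 1 := by
  simpa [Matrix.trace, targetProj] using sum_mul_star_self hG

lemma targetProj_mul_self {ι : Type*} [Fintype ι] {G : EuclideanSpace ℂ ι} (hG : ‖G‖ = 1) :
    targetProj G * targetProj G = targetProj G := by
  ext a b
  simp only [targetProj, Matrix.mul_apply, Matrix.of_apply]
  calc _ = ∑ c, (G a * star (G b)) * (G c * star (G c)) :=
        Finset.sum_congr rfl fun c _ => by ring
    _ = _ := by rw [← Finset.mul_sum, sum_mul_star_self hG, mul_one]

variable {ι : Type*} [DecidableEq ι] {G : EuclideanSpace ℂ ι} {m : ℕ}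

/-- The tensor product of `1 - |G⟩⟨G|` on the systems in `S` and `|G⟩⟨G|` on the others. -/
def sectorProj (G : EuclideanSpace ℂ ι) {m : ℕ} (S : Finset (Fin m)) :
    Matrix (Fin m → ι) (Fin m → ι) ℂ :=
  tensorOp fun j => if j ∈ S then 1 - targetProj G else targetProj G

lemma conjTranspose_sectorProj (S : Finset (Fin m)) : (sectorProj G S)ᴴ = sectorProj G S := by
  rw [sectorProj, conjTranspose_tensorOp]
  congr 1
  ext1 j
  split_ifs <;> simp [conjTranspose_targetProj]

lemma sum_sectorProj : ∑ S : Finset (Fin m), sectorProj G S = 1 := by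
  have := tensorOp_smul_add_smul (fun _ : Fin m => (1 : ℂ)) (fun _ => 1)
    (targetProj G) (1 - targetProj G)
  simp only [one_smul, add_sub_cancel, ite_self, Finset.prod_const_one] at this
  rw [tensorOp_one] at this
  exact this.symm

lemma sectorProj_map (π : Equiv.Perm (Fin m)) (S : Finset (Fin m)) (x y : Fin m → ι) :
    sectorProj G (S.map π.toEmbedding) x y = sectorProj G S (x ∘ π) (y ∘ π) := by
  simp only [sectorProj, tensorOp, Matrix.of_apply]
  rw [← Equiv.prod_comp π]
  simp

end Sector

section Projector

variable {ι : Type*} [Fintype ι] [DecidableEq ι] {G : EuclideanSpace ℂ ι}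

lemma trace_one_sub_targetProj (hG : ‖G‖ = 1) :
    (1 - targetProj G).trace = ((Fintype.card ι : ℝ) - 1 : ℝ) := by
  rw [Matrix.trace_sub, Matrix.trace_one, trace_targetProj hG]
  push_cast
  rfl

/-- The weight of a state in the range of `sectorProj G S`. -/
def sectorWeight (G : EuclideanSpace ℂ ι) {m : ℕ} (ρ : Matrix (Fin m → ι) (Fin m → ι) ℂ)
    (S : Finset (Fin m)) : ℝ :=
  (sectorProj G S * ρ).trace.re

variable {m : ℕ}

lemma sectorProj_mul_self (hG : ‖G‖ = 1) (S : Finset (Fin m)) :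
    sectorProj G S * sectorProj G S = sectorProj G S := by
  rw [sectorProj, tensorOp_mul]
  congr 1
  ext1 j
  have := targetProj_mul_self hG
  split_ifs
  · simp [mul_sub, sub_mul, this]
  · exact this

lemma sectorProj_mul_of_ne (hG : ‖G‖ = 1) {S T : Finset (Fin m)} (h : S ≠ T) :
    sectorProj G S * sectorProj G T = 0 := by
  obtain ⟨j, hj⟩ : ∃ j, ¬(j ∈ S ↔ j ∈ T) := by
    by_contra! hc
    exact h (Finset.ext hc)
  rw [sectorProj, sectorProj, tensorOp_mul]
  refine tensorOp_eq_zero (j := j) ?_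
  have := targetProj_mul_self hG
  by_cases hS : j ∈ S <;> by_cases hT : j ∈ T <;> simp_all [mul_sub, sub_mul]

lemma posSemidef_sectorProj (hG : ‖G‖ = 1) (S : Finset (Fin m)) :
    (sectorProj G S).PosSemidef := by
  have := Matrix.posSemidef_conjTranspose_mul_self (sectorProj G S)
  rwa [conjTranspose_sectorProj, sectorProj_mul_self hG] at this

lemma trace_sectorProj (hG : ‖G‖ = 1) (S : Finset (Fin m)) :
    (sectorProj G S).trace = ((((Fintype.card ι : ℝ) - 1) ^ S.card : ℝ) : ℂ) := by
  rw [sectorProj, trace_tensorOp]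
  simp only [apply_ite Matrix.trace, trace_targetProj hG, trace_one_sub_targetProj hG]
  rw [Finset.prod_ite_mem, Finset.univ_inter, Finset.prod_const]
  push_cast
  rfl

variable {ρ : Matrix (Fin m → ι) (Fin m → ι) ℂ}

/-- For a projector `P`, the trace of `P * ρ` is that of `P * ρ * P`. -/
lemma sectorWeight_nonneg (hG : ‖G‖ = 1) (hρ : ρ.PosSemidef) (S : Finset (Fin m)) :
    0 ≤ sectorWeight G ρ S := by
  have h := (hρ.mul_mul_conjTranspose_same (sectorProj G S)).trace_nonneg
  rw [Matrix.trace_mul_comm, ← mul_assoc, conjTranspose_sectorProj, sectorProj_mul_self hG] at h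
  exact (Complex.le_def.1 h).1

lemma sum_sectorWeight (hρ : ρ.trace = 1) : ∑ S : Finset (Fin m), sectorWeight G ρ S = 1 := by
  simp only [sectorWeight]
  rw [← Complex.re_sum, ← Matrix.trace_sum, ← Finset.sum_mul, sum_sectorProj, one_mul, hρ,
    Complex.one_re]

lemma sectorWeight_eq_of_card_eq (hρ : IsPermInvariant ρ) {S T : Finset (Fin m)}
    (h : S.card = T.card) : sectorWeight G ρ S = sectorWeight G ρ T := by
  obtain ⟨π, hπ⟩ := exists_perm_comp_eq (fun j => decide (j ∈ S)) (fun j => decide (j ∈ T)) <| by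
    rintro (_ | _)
    · simp [Fintype.card_subtype_compl, h]
    · simp [h]
  unfold sectorWeight sectorProj
  rw [← trace_tensorOp_comp_mul hρ (fun j => if j ∈ S then 1 - targetProj G else targetProj G) π]
  congr 5
  ext1 j
  have := congrFun hπ j
  simp only [Function.comp_apply, decide_eq_decide] at this ⊢
  simp [this]

end Projector

/-! ### Acceptance and fidelity in terms of level weights. -/

section Expansion

variable {ι : Type*} [Fintype ι] [DecidableEq ι] {N : ℕ}

/-- The tests of `testOp`, with the failures on the systems in `I`. -/
def testAt (Ω E : Matrix ι ι ℂ) (I : Finset (Fin (N + 1))) (j : Fin (N + 1)) : Matrix ι ι ℂ :=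
  if j = Fin.last N then E else if j ∈ I then 1 - Ω else Ω

lemma trace_tensorOp_testAt_eq {ρ : Matrix (Fin (N + 1) → ι) (Fin (N + 1) → ι) ℂ}
    (hρ : IsPermInvariant ρ) (Ω E : Matrix ι ι ℂ) {I J : Finset (Fin (N + 1))}
    (hI : Fin.last N ∉ I) (hJ : Fin.last N ∉ J) (h : I.card = J.card) :
    (tensorOp (testAt Ω E I) * ρ).trace = (tensorOp (testAt Ω E J) * ρ).trace := by
  -- Three colours: the untested last system, failed tests, passed tests. Colourings with equal
  -- counts differ by a permutation.
  let col (I : Finset (Fin (N + 1))) (j : Fin (N + 1)) : Option Bool :=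
    if j = Fin.last N then none else some (decide (j ∈ I))
  have hfib (I : Finset (Fin (N + 1))) (hI : Fin.last N ∉ I) (o : Option Bool) :
      Fintype.card {x // col I x = o} =
        match o with
        | none => 1
        | some true => I.card
        | some false => N - I.card := by
    rw [Fintype.card_subtype]
    rcases o with _ | _ | _
    · have : Finset.univ.filter (fun x => col I x = none) = {Fin.last N} := by
        ext j
        simp [col]
      simp [this]
    · have : Finset.univ.filter (fun x => col I x = some false) =
          Finset.univ.erase (Fin.last N) \ I := by
        ext j
        by_cases hj : j = Fin.last N <;> simp [col, hj]
      rw [this, Finset.card_sdiff_of_subset (fun j hj => Finset.mem_erase.2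
        ⟨ne_of_mem_of_not_mem hj hI, Finset.mem_univ j⟩)]
      simp
    · have : Finset.univ.filter (fun x => col I x = some true) = I := by
        ext j
        by_cases hj : j = Fin.last N
        · simp [col, hj, hI]
        · simp [col, hj]
      simp [this]
  obtain ⟨π, hπ⟩ := exists_perm_comp_eq (col J) (col I) fun o => by
    rw [hfib J hJ, hfib I hI, h]
  let val : Option Bool → Matrix ι ι ℂ := fun o => o.elim E fun b => if b then 1 - Ω else Ω
  have hval (I : Finset (Fin (N + 1))) : testAt Ω E I = val ∘ col I := by
    ext1 j
    by_cases hj : j = Fin.last N <;> simp [testAt, val, col, hj]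
  rw [hval I, hval J, ← hπ, ← Function.comp_assoc, trace_tensorOp_comp_mul hρ]

/-- The binomial coefficient counts the sets of failing tests, all equally likely by invariance. -/
lemma choose_mul_trace_testOp {ρ : Matrix (Fin (N + 1) → ι) (Fin (N + 1) → ι) ℂ}
    (hρ : IsPermInvariant ρ) (Ω E : Matrix ι ι ℂ) (i : ℕ) :
    (N.choose i : ℝ) * (testOp Ω E N i * ρ).trace.re =
      ∑ I ∈ (Finset.univ.erase (Fin.last N)).powersetCard i,
        (tensorOp (testAt Ω E I) * ρ).trace.re := by
  have hcard : ((Finset.univ.erase (Fin.last N)).powersetCard i).card = N.choose i := by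
    simp [Finset.card_powersetCard]
  have hterm : ∀ I ∈ (Finset.univ.erase (Fin.last N)).powersetCard i,
      (tensorOp (testAt Ω E I) * ρ).trace.re = (testOp Ω E N i * ρ).trace.re := by
    intro I hI
    rw [Finset.mem_powersetCard] at hI
    have hiN : i ≤ N := by simpa [hI.2] using Finset.card_le_card hI.1
    -- The positions where `testOp` places its failures.
    let J : Finset (Fin (N + 1)) := Finset.univ.filter fun j => N - i ≤ (j : ℕ) ∧ (j : ℕ) < N
    have hJ : J.card = i := by
      have : J.map Fin.valEmbedding = Finset.Ico (N - i) N := by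
        ext a
        simp only [J, Finset.mem_map, Finset.mem_filter, Finset.mem_univ, true_and,
          Fin.valEmbedding_apply, Finset.mem_Ico]
        exact ⟨fun ⟨b, hb, e⟩ => e ▸ hb, fun h => ⟨⟨a, by omega⟩, h, rfl⟩⟩
      rw [← Finset.card_map Fin.valEmbedding, this, Nat.card_Ico]
      omega
    have htest : testOp Ω E N i = tensorOp (testAt Ω E J) := by
      unfold testOp
      congr 1
      ext1 j
      have hj := j.2
      simp only [testAt, J, Finset.mem_filter, Finset.mem_univ, true_and, Fin.ext_iff,
        Fin.val_last]
      split_ifs <;> first | rfl | omega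
    rw [htest, trace_tensorOp_testAt_eq hρ Ω E (fun h => by simpa using hI.1 h) (by simp [J])
      (hI.2.trans hJ.symm)]
  rw [Finset.sum_congr rfl hterm, Finset.sum_const, hcard, nsmul_eq_mul]

lemma trace_tensorOp_smul_add_smul {m : ℕ} (G : EuclideanSpace ℂ ι)
    (ρ : Matrix (Fin m → ι) (Fin m → ι) ℂ) (a b : Fin m → ℝ) :
    (tensorOp (fun j => (a j : ℂ) • targetProj G + (b j : ℂ) • (1 - targetProj G)) * ρ).trace.re =
      ∑ S : Finset (Fin m), (∏ j, if j ∈ S then b j else a j) * sectorWeight G ρ S := by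
  rw [tensorOp_smul_add_smul, Finset.sum_mul, Matrix.trace_sum, Complex.re_sum]
  refine Finset.sum_congr rfl fun S _ => ?_
  have : (∏ j, if j ∈ S then (b j : ℂ) else a j) = ((∏ j, if j ∈ S then b j else a j : ℝ) : ℂ) := by
    push_cast
    exact Finset.prod_congr rfl fun j _ => by split_ifs <;> rfl
  rw [this, smul_mul_assoc, Matrix.trace_smul, smul_eq_mul, Complex.re_ofReal_mul]
  rfl

/-- Target systems never fail, so only sets `I` of failures inside `S` without the last system
contribute. -/
lemma sum_prod_eq_binomTerm (lam e : ℝ) (i : ℕ) (S : Finset (Fin (N + 1))) :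
    ∑ I ∈ (Finset.univ.erase (Fin.last N)).powersetCard i,
      ∏ j, (if j ∈ S then (if j = Fin.last N then e else if j ∈ I then 1 - lam else lam)
        else (if j = Fin.last N then 1 else if j ∈ I then 0 else 1)) =
      (if Fin.last N ∈ S then e else 1) * binomTerm lam (S.erase (Fin.last N)).card i := by
  set S' := S.erase (Fin.last N)
  have hS' : S' ⊆ Finset.univ.erase (Fin.last N) :=
    Finset.erase_subset_erase _ (Finset.subset_univ _)
  have hsplit (I : Finset (Fin (N + 1))) :
      ∏ j, (if j ∈ S then (if j = Fin.last N then e else if j ∈ I then 1 - lam else lam)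
        else (if j = Fin.last N then 1 else if j ∈ I then 0 else 1)) =
      (if Fin.last N ∈ S then e else 1) * ∏ j ∈ Finset.univ.erase (Fin.last N),
        (if j ∈ S then (if j ∈ I then 1 - lam else lam) else (if j ∈ I then 0 else 1)) := by
    rw [← Finset.mul_prod_erase _ _ (Finset.mem_univ (Fin.last N))]
    congr 1
    · simp
    · refine Finset.prod_congr rfl fun j hj => ?_
      simp [Finset.ne_of_mem_erase hj]
  simp only [hsplit, ← Finset.mul_sum]
  congr 1
  rw [← Finset.sum_subset (Finset.powersetCard_mono hS') ?_]
  · have hterm : ∀ I ∈ S'.powersetCard i, ∏ j ∈ Finset.univ.erase (Fin.last N),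
        (if j ∈ S then (if j ∈ I then 1 - lam else lam) else (if j ∈ I then 0 else 1)) =
        (1 - lam) ^ i * lam ^ (S'.card - i) := by
      intro I hI
      rw [Finset.mem_powersetCard] at hI
      rw [← Finset.prod_subset hS' ?_, ← Finset.prod_sdiff hI.1, mul_comm]
      · congr 1
        · rw [← hI.2]
          refine Finset.prod_eq_pow_card fun j hj => ?_
          simp [hj, Finset.mem_of_mem_erase (hI.1 hj)]
        · rw [← hI.2, ← Finset.card_sdiff_of_subset hI.1]
          refine Finset.prod_eq_pow_card fun j hj => ?_
          rw [Finset.mem_sdiff] at hj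
          simp [hj.2, Finset.mem_of_mem_erase hj.1]
      · intro j hj hjS
        have h1 : j ∉ S := fun h => hjS (Finset.mem_erase.2 ⟨Finset.ne_of_mem_erase hj, h⟩)
        have h2 : j ∉ I := fun h => hjS (hI.1 h)
        simp [h1, h2]
    rw [Finset.sum_congr rfl hterm, Finset.sum_const, Finset.card_powersetCard, nsmul_eq_mul,
      binomTerm, mul_assoc]
  · intro I hI hIS
    rw [Finset.mem_powersetCard] at hI
    obtain ⟨j, hjI, hjS⟩ : ∃ j ∈ I, j ∉ S' := by
      by_contra! hc
      exact hIS (Finset.mem_powersetCard.2 ⟨hc, hI.2⟩)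
    refine Finset.prod_eq_zero (hI.1 hjI) ?_
    have : j ∉ S := fun h => hjS (Finset.mem_erase.2 ⟨Finset.ne_of_mem_erase (hI.1 hjI), h⟩)
    simp [this, hjI]

/-- The parameter `e` treats both quantities at once: `e = 1` puts the identity on the last system,
`e = 0` the target projector. -/
lemma sum_choose_mul_trace_testOp {ρ : Matrix (Fin (N + 1) → ι) (Fin (N + 1) → ι) ℂ}
    (hρ : IsPermInvariant ρ) (G : EuclideanSpace ℂ ι) (lam e : ℝ) (K : ℕ) :
    ∑ i ∈ Finset.range K, (N.choose i : ℝ) *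
      (testOp (verifOp G lam) (targetProj G + (e : ℂ) • (1 - targetProj G)) N i * ρ).trace.re =
    ∑ S : Finset (Fin (N + 1)), (if Fin.last N ∈ S then e else 1) *
      passProb lam (S.erase (Fin.last N)).card K * sectorWeight G ρ S := by
  have hop (I : Finset (Fin (N + 1))) :
      testAt (verifOp G lam) (targetProj G + (e : ℂ) • (1 - targetProj G)) I = fun j =>
        ((if j = Fin.last N then 1 else if j ∈ I then 0 else 1 : ℝ) : ℂ) • targetProj G +
        ((if j = Fin.last N then e else if j ∈ I then 1 - lam else lam : ℝ) : ℂ) •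
          (1 - targetProj G) := by
    ext1 j
    unfold testAt verifOp
    split_ifs
    · simp
    · push_cast
      module
    · simp
  simp only [choose_mul_trace_testOp hρ, hop, trace_tensorOp_smul_add_smul]
  have hi (i : ℕ) : ∑ I ∈ (Finset.univ.erase (Fin.last N)).powersetCard i,
      ∑ S : Finset (Fin (N + 1)),
        (∏ j, if j ∈ S then (if j = Fin.last N then e else if j ∈ I then 1 - lam else lam)
        else (if j = Fin.last N then 1 else if j ∈ I then 0 else 1)) * sectorWeight G ρ S =
      ∑ S : Finset (Fin (N + 1)), (if Fin.last N ∈ S then e else 1) *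
        binomTerm lam (S.erase (Fin.last N)).card i * sectorWeight G ρ S := by
    rw [Finset.sum_comm]
    refine Finset.sum_congr rfl fun S _ => ?_
    rw [← Finset.sum_mul, sum_prod_eq_binomTerm]
  simp only [hi]
  rw [Finset.sum_comm]
  refine Finset.sum_congr rfl fun S _ => ?_
  rw [← Finset.sum_mul, ← Finset.mul_sum]
  rfl

/-- The probability that exactly `j` of the systems are found orthogonal to the target. -/
def levelWeight (G : EuclideanSpace ℂ ι) {m : ℕ} (ρ : Matrix (Fin m → ι) (Fin m → ι) ℂ)
    (j : ℕ) : ℝ :=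
  ∑ S ∈ Finset.univ.powersetCard j, sectorWeight G ρ S

lemma sum_finset_fin {M : Type*} [AddCommMonoid M] (m : ℕ) (f : Finset (Fin m) → M) :
    ∑ S : Finset (Fin m), f S =
      ∑ j : Fin (m + 1), ∑ S ∈ Finset.univ.powersetCard (j : ℕ), f S := by
  rw [← Finset.powerset_univ, Finset.sum_powerset, Finset.card_univ, Fintype.card_fin,
    Finset.sum_range]

/-- All sets of size `j` have equal weight, and a fraction `(N + 1 - j) / (N + 1)` of them avoids
the last system. -/
lemma sum_sectorWeight_last_notMem {ρ : Matrix (Fin (N + 1) → ι) (Fin (N + 1) → ι) ℂ}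
    (hρ : IsPermInvariant ρ) (G : EuclideanSpace ℂ ι) {j : ℕ} (hj : j ≤ N + 1) :
    ∑ S ∈ Finset.univ.powersetCard j, (if Fin.last N ∈ S then 0 else sectorWeight G ρ S) =
      ((N : ℝ) + 1 - j) / (N + 1) * levelWeight G ρ j := by
  obtain ⟨T, -, hT⟩ := Finset.exists_subset_card_eq (s := (Finset.univ : Finset (Fin (N + 1))))
    (n := j) (by simpa using hj)
  have hq : ∀ S ∈ Finset.univ.powersetCard j, sectorWeight G ρ S = sectorWeight G ρ T :=
    fun S hS => sectorWeight_eq_of_card_eq hρ ((Finset.mem_powersetCard.1 hS).2.trans hT.symm)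
  have hfilter : (Finset.univ.powersetCard j).filter (fun S => Fin.last N ∉ S) =
      (Finset.univ.erase (Fin.last N)).powersetCard j := by
    ext S
    simp [Finset.mem_powersetCard, Finset.subset_erase, and_comm]
  have hL : levelWeight G ρ j = ((N + 1).choose j : ℝ) * sectorWeight G ρ T := by
    rw [levelWeight, Finset.sum_congr rfl hq]
    simp
  have hR : ∑ S ∈ Finset.univ.powersetCard j, (if Fin.last N ∈ S then 0 else sectorWeight G ρ S) =
      (N.choose j : ℝ) * sectorWeight G ρ T := by
    simp only [← ite_not (p := Fin.last N ∈ _)]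
    rw [← Finset.sum_filter, Finset.sum_congr rfl fun S hS => hq S (Finset.mem_filter.1 hS).1,
      hfilter]
    simp
  have hc : (N.choose j : ℝ) * (N + 1) = (N + 1).choose j * ((N : ℝ) + 1 - j) := by
    have := Nat.choose_mul_succ_eq N j
    rw [← Nat.cast_inj (R := ℝ)] at this
    push_cast [Nat.cast_sub hj] at this
    exact this
  rw [hL, hR]
  field_simp
  linear_combination sectorWeight G ρ T * hc

lemma sum_mul_sectorWeight {ρ : Matrix (Fin (N + 1) → ι) (Fin (N + 1) → ι) ℂ}
    (hρ : IsPermInvariant ρ) (G : EuclideanSpace ℂ ι) (lam e : ℝ) (K : ℕ) :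
    ∑ S : Finset (Fin (N + 1)), (if Fin.last N ∈ S then e else 1) *
      passProb lam (S.erase (Fin.last N)).card K * sectorWeight G ρ S =
    ∑ j : Fin (N + 2), levelWeight G ρ j *
      (fidPoint lam K N j + e * (accPoint lam K N j - fidPoint lam K N j)) := by
  rw [sum_finset_fin]
  refine Finset.sum_congr rfl fun j _ => ?_
  have hj : (j : ℕ) ≤ N + 1 := by omega
  have hterm : ∀ S ∈ Finset.univ.powersetCard (j : ℕ), (if Fin.last N ∈ S then e else 1) *
      passProb lam (S.erase (Fin.last N)).card K * sectorWeight G ρ S =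
      e * passProb lam (j - 1) K * sectorWeight G ρ S +
      (passProb lam j K - e * passProb lam (j - 1) K) *
        (if Fin.last N ∈ S then 0 else sectorWeight G ρ S) := by
    intro S hS
    have hS := (Finset.mem_powersetCard.1 hS).2
    split_ifs with h
    · rw [Finset.card_erase_of_mem h, hS]
      ring
    · rw [Finset.erase_eq_of_notMem h, hS]
      ring
  rw [Finset.sum_congr rfl hterm, Finset.sum_add_distrib, ← Finset.mul_sum, ← Finset.mul_sum,
    sum_sectorWeight_last_notMem hρ G hj, ← levelWeight]
  unfold accPoint fidPoint
  field_simp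
  ring

lemma acceptProb_eq {ρ : Matrix (Fin (N + 1) → ι) (Fin (N + 1) → ι) ℂ}
    (hρ : IsPermInvariant ρ) (G : EuclideanSpace ℂ ι) (lam : ℝ) (k : ℕ) :
    acceptProb G lam k N ρ =
      ∑ j : Fin (N + 2), levelWeight G ρ j * accPoint lam (k + 1) N j := by
  have h := (sum_choose_mul_trace_testOp hρ G lam 1 (k + 1)).trans
    (sum_mul_sectorWeight hρ G lam 1 (k + 1))
  simpa [acceptProb] using h

lemma acceptFid_eq {ρ : Matrix (Fin (N + 1) → ι) (Fin (N + 1) → ι) ℂ}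
    (hρ : IsPermInvariant ρ) (G : EuclideanSpace ℂ ι) (lam : ℝ) (k : ℕ) :
    acceptFid G lam k N ρ =
      ∑ j : Fin (N + 2), levelWeight G ρ j * fidPoint lam (k + 1) N j := by
  have h := (sum_choose_mul_trace_testOp hρ G lam 0 (k + 1)).trans
    (sum_mul_sectorWeight hρ G lam 0 (k + 1))
  simpa [acceptFid] using h

lemma levelWeight_mem_stdSimplex {G : EuclideanSpace ℂ ι} (hG : ‖G‖ = 1) {m : ℕ}
    {ρ : Matrix (Fin m → ι) (Fin m → ι) ℂ} (hρ : IsDensity ρ) :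
    (fun j : Fin (m + 1) => levelWeight G ρ j) ∈ stdSimplex ℝ (Fin (m + 1)) :=
  ⟨fun _ => Finset.sum_nonneg fun _ _ => sectorWeight_nonneg hG hρ.1 _,
    (sum_finset_fin m (sectorWeight G ρ)).symm.trans (sum_sectorWeight hρ.2)⟩

end Expansion

/-! ### States realizing prescribed level weights. -/

section State

variable {ι : Type*} [Fintype ι] [DecidableEq ι] {G : EuclideanSpace ℂ ι} {m : ℕ}

/-- The permutation-invariant state that is maximally mixed on each level and has weight `c j` on
level `j`. -/
def levelState (G : EuclideanSpace ℂ ι) (m : ℕ) (c : ℕ → ℝ) :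
    Matrix (Fin m → ι) (Fin m → ι) ℂ :=
  ∑ S : Finset (Fin m),
    ((c S.card / (m.choose S.card * ((Fintype.card ι : ℝ) - 1) ^ S.card) : ℝ) : ℂ) •
      sectorProj G S

lemma isPermInvariant_levelState (c : ℕ → ℝ) : IsPermInvariant (levelState G m c) := by
  intro π x y
  simp only [levelState, Matrix.sum_apply, Matrix.smul_apply]
  symm
  rw [← Equiv.sum_comp π.finsetCongr]
  simp [sectorProj_map]

/-- The denominator in `levelState` is the dimension of the whole level. In dimension one it
vanishes for `j ≥ 1`, and `hd` forbids weight on these empty levels. -/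
lemma sectorWeight_levelState (hG : ‖G‖ = 1) {c : ℕ → ℝ}
    (hd : ∀ j, ((Fintype.card ι : ℝ) - 1) ^ j = 0 → c j = 0) (S : Finset (Fin m)) :
    sectorWeight G (levelState G m c) S = c S.card / m.choose S.card := by
  rw [sectorWeight, levelState, Finset.mul_sum, Finset.sum_eq_single S]
  · rw [mul_smul_comm, sectorProj_mul_self hG, Matrix.trace_smul, trace_sectorProj hG,
      smul_eq_mul, ← Complex.ofReal_mul, Complex.ofReal_re]
    by_cases h : ((Fintype.card ι : ℝ) - 1) ^ S.card = 0
    · simp [hd _ h]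
    · rw [← div_div, div_mul_cancel₀ _ h]
  · intro T _ hT
    rw [mul_smul_comm, sectorProj_mul_of_ne hG hT.symm, smul_zero]
  · simp

lemma levelWeight_levelState (hG : ‖G‖ = 1) {c : ℕ → ℝ}
    (hd : ∀ j, ((Fintype.card ι : ℝ) - 1) ^ j = 0 → c j = 0) {j : ℕ} (hj : j ≤ m) :
    levelWeight G (levelState G m c) j = c j := by
  have h : ∀ S ∈ (Finset.univ : Finset (Fin m)).powersetCard j,
      sectorWeight G (levelState G m c) S = c j / m.choose j := fun S hS => by
    rw [sectorWeight_levelState hG hd, (Finset.mem_powersetCard.1 hS).2]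
  have h0 : (m.choose j : ℝ) ≠ 0 := by exact_mod_cast (Nat.choose_pos hj).ne'
  rw [levelWeight, Finset.sum_congr rfl h, Finset.sum_const, Finset.card_powersetCard]
  simp only [Finset.card_univ, Fintype.card_fin, nsmul_eq_mul]
  field_simp

lemma isDensity_levelState (hG : ‖G‖ = 1) (hι : 1 ≤ Fintype.card ι) {c : ℕ → ℝ}
    (hc : ∀ j, 0 ≤ c j) (hsum : ∑ j : Fin (m + 1), c j = 1)
    (hd : ∀ j, ((Fintype.card ι : ℝ) - 1) ^ j = 0 → c j = 0) :
    IsDensity (levelState G m c) := by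
  have hι' : 0 ≤ (Fintype.card ι : ℝ) - 1 := by
    have : (1 : ℝ) ≤ Fintype.card ι := by exact_mod_cast hι
    linarith
  have hpsd : (levelState G m c).PosSemidef := by
    refine Matrix.posSemidef_sum _ fun S _ => (posSemidef_sectorProj hG S).smul ?_
    rw [Complex.zero_le_real]
    have := hc S.card
    positivity
  refine ⟨hpsd, Complex.ext ?_ ?_⟩
  · rw [← one_mul (levelState G m c), ← sum_sectorProj (G := G), Finset.sum_mul, Matrix.trace_sum,
      Complex.re_sum]
    change ∑ S, sectorWeight G (levelState G m c) S = 1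
    rw [sum_finset_fin, ← hsum]
    exact Finset.sum_congr rfl fun j _ => levelWeight_levelState hG hd (by omega)
  · exact (Complex.le_def.1 hpsd.trace_nonneg).2.symm

end State

/-! ### From states to the classical problem. -/

section Feasible

lemma one_le_card {ι : Type*} [Fintype ι] {G : EuclideanSpace ℂ ι} (hG : ‖G‖ = 1) :
    1 ≤ Fintype.card ι := by
  by_contra! h
  have : IsEmpty ι := Fintype.card_eq_zero_iff.1 (by omega)
  simp [EuclideanSpace.norm_eq] at hG

variable {ι : Type*} [Fintype ι] [DecidableEq ι] {G : EuclideanSpace ℂ ι}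

lemma feasibleFidelities_eq_ratioSet (hG : ‖G‖ = 1) (hι : Fintype.card ι ≠ 1) (lam : ℝ)
    (k N : ℕ) (δ : ℝ) : feasibleFidelities G lam k N δ = ratioSet lam (k + 1) N δ := by
  ext F
  constructor
  · rintro ⟨ρ, hρ, hπ, hδ, rfl⟩
    refine ⟨_, levelWeight_mem_stdSimplex hG hρ, ?_, ?_⟩
    · rwa [← acceptProb_eq hπ]
    · rw [← acceptProb_eq hπ, ← acceptFid_eq hπ, fidelity]
  · rintro ⟨c, hc, hδ, rfl⟩
    let c' : ℕ → ℝ := fun j => if h : j < N + 2 then c ⟨j, h⟩ else 0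
    have hc' (j : Fin (N + 2)) : c' j = c j := by simp [c']
    have hd (j : ℕ) (h : ((Fintype.card ι : ℝ) - 1) ^ j = 0) : c' j = 0 :=
      absurd (by exact_mod_cast sub_eq_zero.1 (eq_zero_of_pow_eq_zero h)) hι
    have hlev (j : Fin (N + 2)) : levelWeight G (levelState G (N + 1) c') j = c j :=
      (levelWeight_levelState hG hd (by omega)).trans (hc' j)
    have hπ := isPermInvariant_levelState (G := G) (m := N + 1) c'
    refine ⟨levelState G (N + 1) c', isDensity_levelState hG (one_le_card hG) (fun j => ?_) ?_ hd,
      hπ, ?_, ?_⟩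
    · unfold c'
      split_ifs
      · exact hc.1 _
      · exact le_rfl
    · simp only [hc']
      exact hc.2
    · rw [acceptProb_eq hπ]
      simpa only [hlev] using hδ
    · rw [fidelity, acceptProb_eq hπ, acceptFid_eq hπ]
      simp only [hlev]

lemma feasibleFidelities_eq_singleton (hG : ‖G‖ = 1) (hι : Fintype.card ι = 1) (lam : ℝ)
    (k N : ℕ) {δ : ℝ} (hδ : δ ≤ 1) : feasibleFidelities G lam k N δ = {1} := by
  have key {ρ : Matrix (Fin (N + 1) → ι) (Fin (N + 1) → ι) ℂ} (hρ : IsDensity ρ)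
      (hπ : IsPermInvariant ρ) : acceptProb G lam k N ρ = 1 ∧ acceptFid G lam k N ρ = 1 := by
    have hz (j : Fin (N + 2)) (hj : j ≠ 0) : levelWeight G ρ j = 0 := by
      refine Finset.sum_eq_zero fun S hS => ?_
      have hS : S.card ≠ 0 := by
        rw [(Finset.mem_powersetCard.1 hS).2]
        exact Fin.val_ne_zero_iff.2 hj
      -- In dimension one nothing is orthogonal to the target: this positive semidefinite matrix has
      -- trace `0`.
      have : sectorProj G S = 0 := by
        rw [← (posSemidef_sectorProj hG S).trace_eq_zero_iff, trace_sectorProj hG, hι]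
        simp [hS]
      simp [sectorWeight, this]
    have h0 : levelWeight G ρ (0 : Fin (N + 2)) = 1 := by
      rw [← (levelWeight_mem_stdSimplex hG hρ).2, Finset.sum_eq_single 0 (fun j _ => hz j)
        (by simp)]
    constructor
    · rw [acceptProb_eq hπ, Finset.sum_eq_single 0 (fun j _ hj => by rw [hz j hj, zero_mul])
        (by simp), h0, Fin.val_zero, accPoint_zero, one_mul]
    · rw [acceptFid_eq hπ, Finset.sum_eq_single 0 (fun j _ hj => by rw [hz j hj, zero_mul])
        (by simp), h0, Fin.val_zero, fidPoint_zero, one_mul]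
  ext F
  rw [Set.mem_singleton_iff]
  constructor
  · rintro ⟨ρ, hρ, hπ, -, rfl⟩
    rw [fidelity, (key hρ hπ).1, (key hρ hπ).2, div_one]
  · rintro rfl
    have hπ := isPermInvariant_levelState (G := G) (m := N + 1) (Pi.single 0 1)
    have hρ : IsDensity (levelState G (N + 1) (Pi.single 0 1)) := by
      refine isDensity_levelState hG hι.ge (fun j => ?_) ?_ fun j hj => ?_
      · rw [Pi.single_apply]
        split_ifs <;> simp
      · rw [Finset.sum_eq_single 0 (fun j _ hj => ?_) (by simp)]
        · simp
        · exact Pi.single_eq_of_ne (Fin.val_ne_zero_iff.2 hj) _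
      · refine Pi.single_eq_of_ne ?_ _
        rintro rfl
        simp at hj
    refine ⟨_, hρ, hπ, ?_, ?_⟩
    · rwa [(key hρ hπ).1]
    · rw [fidelity, (key hρ hπ).1, (key hρ hπ).2, div_one]

lemma exists_isLeast_feasibleFidelities (hG : ‖G‖ = 1) (lam : ℝ) (k N : ℕ) {δ : ℝ} (hδ : 0 < δ)
    (hδ1 : δ ≤ 1) : ∃ m, IsLeast (feasibleFidelities G lam k N δ) m := by
  by_cases hι : Fintype.card ι = 1
  · rw [feasibleFidelities_eq_singleton hG hι lam k N hδ1]
    exact ⟨1, isLeast_singleton⟩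
  · rw [feasibleFidelities_eq_ratioSet hG hι]
    exact exists_isLeast_ratioSet k N hδ hδ1

lemma guaranteedInfidelity_le_of_forall_exists_le (hG : ‖G‖ = 1) (lam : ℝ) {k N k' N' : ℕ}
    {δ δ' : ℝ} (hδ : 0 < δ) (hδ1 : δ ≤ 1) (hδ' : 0 < δ') (hδ1' : δ' ≤ 1)
    (h : ∀ F ∈ feasibleFidelities G lam k N δ, ∃ F' ∈ feasibleFidelities G lam k' N' δ', F' ≤ F) :
    guaranteedInfidelity G lam k N δ ≤ guaranteedInfidelity G lam k' N' δ' := by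
  obtain ⟨a, ha⟩ := exists_isLeast_feasibleFidelities hG lam k N hδ hδ1
  obtain ⟨b, hb⟩ := exists_isLeast_feasibleFidelities hG lam k' N' hδ' hδ1'
  obtain ⟨F', hF', hle⟩ := h a ha.1
  rw [guaranteedInfidelity, guaranteedInfidelity, ha.csInf_eq, hb.csInf_eq]
  linarith [hb.2 hF']

lemma guaranteedInfidelity_le_of_dominated (hG : ‖G‖ = 1) {lam : ℝ} (h0 : 0 ≤ lam) (h1 : lam < 1)
    {k N k' N' : ℕ} {δ : ℝ} (hδ : 0 < δ) (hδ1 : δ ≤ 1)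
    (h : ∀ j ≤ N + 1, (accPoint lam (k + 1) N j, fidPoint lam (k + 1) N j) ∈
      dominated lam (k' + 1) N') :
    guaranteedInfidelity G lam k N δ ≤ guaranteedInfidelity G lam k' N' δ := by
  refine guaranteedInfidelity_le_of_forall_exists_le hG lam hδ hδ1 hδ hδ1 fun F hF => ?_
  by_cases hι : Fintype.card ι = 1
  · rw [feasibleFidelities_eq_singleton hG hι lam _ _ hδ1] at hF ⊢
    exact ⟨F, hF, le_rfl⟩
  · rw [feasibleFidelities_eq_ratioSet hG hι] at hF ⊢
    exact exists_le_of_subset_dominated hδ h0 h1 h hF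

end Feasible

end GraphVerification
end

/-- The first conjunct says that the minimum in the definition of the guaranteed infidelity exists;
the other three are its monotonicity in `δ`, in `N` and in `k`. -/
theorem proposition1 {ι : Type*} [Fintype ι] [DecidableEq ι]
    (G : EuclideanSpace ℂ ι) (hG : ‖G‖ = 1)
    (lam : ℝ) (hlam0 : 0 ≤ lam) (hlam1 : lam < 1) :
    (∀ (k N : ℕ) (δ : ℝ), k + 1 ≤ N → 0 < δ → δ ≤ 1 →
      IsLeast (GraphVerification.feasibleFidelities G lam k N δ)
        (1 - GraphVerification.guaranteedInfidelity G lam k N δ)) ∧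
    (∀ k N : ℕ, k + 1 ≤ N →
      AntitoneOn (fun δ : ℝ => GraphVerification.guaranteedInfidelity G lam k N δ)
        (Set.Ioc 0 1)) ∧
    (∀ (k : ℕ) (δ : ℝ), 0 < δ → δ ≤ 1 →
      AntitoneOn (fun N : ℕ => GraphVerification.guaranteedInfidelity G lam k N δ)
        {N | k + 1 ≤ N}) ∧
    (∀ (N : ℕ) (δ : ℝ), 0 < δ → δ ≤ 1 →
      MonotoneOn (fun k : ℕ => GraphVerification.guaranteedInfidelity G lam k N δ)
        {k | k + 1 ≤ N}) := by
  refine ⟨fun k N δ _ hδ hδ1 => ?_, fun k N _ δ hδ δ' hδ' hle => ?_, fun k δ hδ hδ1 => ?_,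
    fun N δ hδ hδ1 => ?_⟩
  · obtain ⟨a, ha⟩ :=
      GraphVerification.exists_isLeast_feasibleFidelities hG lam k N hδ hδ1
    rwa [GraphVerification.guaranteedInfidelity, ha.csInf_eq, sub_sub_cancel]
  · refine GraphVerification.guaranteedInfidelity_le_of_forall_exists_le hG lam hδ'.1 hδ'.2
      hδ.1 hδ.2 ?_
    rintro F ⟨ρ, hρ, hπ, hp, rfl⟩
    -- A state feasible for the larger threshold is feasible for the smaller.
    exact ⟨_, ⟨ρ, hρ, hπ, hle.trans hp, rfl⟩, le_rfl⟩
  · refine Antitone.antitoneOn (antitone_nat_of_succ_le fun N => ?_) _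
    exact GraphVerification.guaranteedInfidelity_le_of_dominated hG hlam0 hlam1 hδ hδ1
      fun j hj => GraphVerification.mem_dominated_of_succ_left hlam0 hlam1 hj
  · refine Monotone.monotoneOn (monotone_nat_of_le_succ fun k => ?_) _
    exact GraphVerification.guaranteedInfidelity_le_of_dominated hG hlam0 hlam1 hδ hδ1
      fun j hj => GraphVerification.mem_dominated_succ_right hlam0 hlam1 hj
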